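/- An $n$-player game ($n\ge 1$) with a common finite non-empty action set $\mathcal A$ is given by payoff functions $U_1,\dots,U_n:\mathcal A^n\to\mathbb R$. It is zero-sum if $\sum_i U_i(a)=0$ for all $a\in\mathcal A^n$, and symmetric if $U_i(a_{\pi(1)},\dots,a_{\pi(n)})=U_{\pi(i)}(a_1,\dots,a_n)$ for all permutations $\pi$ of $\{1,\dots,n\}$, all $i$ and all $a$. Let $\Delta(\mathcal A)$ be the set of probability vectors on $\mathcal A$, and for $x_1,x\in\Delta(\mathcal A)$ let $U_1(x_1,x^{\otimes n-1})$ be the expected payoff of player 1 when the actions are drawn independently, that of player 1 from $x_1$ and that of every other player from $x$. The three-player majority game has $\mathcal A=\{0,1\}$; all payoffs are $0$ if the three actions agree, and otherwise each of the two players in the majority receives $1/2$ and the player in the minority receives $-1$. (i) For every symmetric zero-sum game, all maxima and minima below are attained (both the inner and the outer ones), and $$\max_{x_1\in\Delta(\mathcal A)}\ \min_{x\in\Delta(\mathcal A)} U_1(x_1,x^{\otimes n-1})\ \le\ \min_{x\in\Delta(\mathcal A)}\ \max_{x_1\in\Delta(\mathcal A)} U_1(x_1,x^{\otimes n-1})\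 =\ 0 .$$ (ii) The three-player majority game is symmetric and zero-sum, and for it the inequality is strict: $\max_{x_1}\min_x U_1(x_1,x^{\otimes 2})\le -\tfrac12$. (iii) Consequently an equal share (a payoff of $0$) cannot be guaranteed against arbitrarily adaptive identical opponents: in the repeated three-player majority game, let a learner (player 1) choose her mixed strategy $x^t$ in each round $t$ by an arbitrary rule from the action profiles of the previous rounds. Then there is a rule choosing in each round, from the same history, one mixed strategy $y^t$ played by both opponents, such that for every sequence of action profiles and every $T\ge1$ $$\frac1T\sum_{t=1}^{T}U_1\bigl(x^t,(y^t)^{\otimes 2}\bigr)\le-\tfrac12 .$$ -/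

import Mathlib

open scoped BigOperators

noncomputable section

/-- The payoff functions of an `n`-player normal-form game in which every player has the action
set `A`: `U i a` is the payoff of player `i` at the action profile `a`.  The players are the
elements of `Fin n`; the learner, called player 1 in the text, is the player `0 : Fin n`. -/
abbrev Payoffs (n : ℕ) (A : Type*) := Fin n → (Fin n → A) → ℝ

/-- The payoffs of all players sum to zero at each action profile. -/
def Payoffs.IsZeroSum {n : ℕ} {A : Type*} (U : Payoffs n A) : Prop :=
  ∀ a : Fin n → A, ∑ i, U i a = 0

/-- The game is invariant under renaming the players: if player `i` takes over the action that
player `π i` has in the profile `a`, for all `i`, then `i` receives what `π i` received. -/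
def Payoffs.IsSymmetric {n : ℕ} {A : Type*} (U : Payoffs n A) : Prop :=
  ∀ (π : Equiv.Perm (Fin n)) (i : Fin n) (a : Fin n → A), U i (fun j => a (π j)) = U (π i) a

/-- Mixed strategies: probability vectors on the action set. -/
abbrev MixedStrategy (A : Type*) [Fintype A] := stdSimplex ℝ A

/-- The expected payoff of player `i` when the players draw their actions independently, player
`j` from the mixed strategy `x j`. -/
def Payoffs.expected {n : ℕ} {A : Type*} [Fintype A] (U : Payoffs n A) (i : Fin n)
    (x : Fin n → MixedStrategy A) : ℝ :=
  ∑ a : Fin n → A, (∏ j, (x j).1 (a j)) * U i a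

/-- `U₁(x₁, x^{⊗ (n-1)})`: the learner plays `x₁`, each of the other players plays `x`. -/
def Payoffs.vsIdentical {n : ℕ} [NeZero n] {A : Type*} [Fintype A] (U : Payoffs n A)
    (x₁ x : MixedStrategy A) : ℝ :=
  U.expected 0 (Function.update (fun _ => x) 0 x₁)

/-- `min_x U₁(x₁, x^{⊗ (n-1)})`. -/
def Payoffs.worstCase {n : ℕ} [NeZero n] {A : Type*} [Fintype A] (U : Payoffs n A)
    (x₁ : MixedStrategy A) : ℝ :=
  ⨅ x : MixedStrategy A, U.vsIdentical x₁ x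

/-- `max_{x₁} U₁(x₁, x^{⊗ (n-1)})`. -/
def Payoffs.bestResponse {n : ℕ} [NeZero n] {A : Type*} [Fintype A] (U : Payoffs n A)
    (x : MixedStrategy A) : ℝ :=
  ⨆ x₁ : MixedStrategy A, U.vsIdentical x₁ x

/-- `max_{x₁} min_x U₁(x₁, x^{⊗ (n-1)})`. -/
def Payoffs.maxMin {n : ℕ} [NeZero n] {A : Type*} [Fintype A] (U : Payoffs n A) : ℝ :=
  ⨆ x₁ : MixedStrategy A, U.worstCase x₁

/-- `min_x max_{x₁} U₁(x₁, x^{⊗ (n-1)})`. -/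
def Payoffs.minMax {n : ℕ} [NeZero n] {A : Type*} [Fintype A] (U : Payoffs n A) : ℝ :=
  ⨅ x : MixedStrategy A, U.bestResponse x

/-- All the optima in `maxMin` and `minMax` are attained, so that they are genuine maxima and
minima. -/
def Payoffs.OptimaAttained {n : ℕ} [NeZero n] {A : Type*} [Fintype A] (U : Payoffs n A) : Prop :=
  (∀ x₁ : MixedStrategy A, IsLeast (Set.range fun x => U.vsIdentical x₁ x) (U.worstCase x₁)) ∧
  IsGreatest (Set.range U.worstCase) U.maxMin ∧
  (∀ x : MixedStrategy A, IsGreatest (Set.range fun x₁ => U.vsIdentical x₁ x)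
    (U.bestResponse x)) ∧
  IsLeast (Set.range U.bestResponse) U.minMax

/-- The three-player majority game: payoff `0` if all actions agree; otherwise `1/2` for a player
in the majority (some other player takes the same action) and `-1` for the player in the
minority. -/
def majorityGame : Payoffs 3 (Fin 2) := fun i a =>
  if ∀ j k, a j = a k then 0
  else if ∃ j, j ≠ i ∧ a j = a i then 1 / 2
  else -1

/-- A rule for repeated play: at round `t` it chooses a mixed strategy from the action profiles
that were played in the rounds `0, …, t - 1`. -/
abbrev AdaptiveRule (n : ℕ) (A : Type*) [Fintype A] :=
  (t : ℕ) → (Fin t → (Fin n → A)) → MixedStrategy A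

/-- The average payoff `(1/T) ∑ₜ U₁(xᵗ, (yᵗ)^{⊗ (n-1)})` of the learner over the first `T` rounds,
along the play `a`, where `xᵗ` is chosen by the rule `learner` and the common strategy `yᵗ` of all
opponents by the rule `opponents`. -/
def Payoffs.averagePayoff {n : ℕ} [NeZero n] {A : Type*} [Fintype A] (U : Payoffs n A)
    (learner opponents : AdaptiveRule n A) (a : ℕ → (Fin n → A)) (T : ℕ) : ℝ :=
  (1 / (T : ℝ)) * ∑ t ∈ Finset.range T,
    U.vsIdentical (learner t fun s => a s) (opponents t fun s => a s)

end

/-! By symmetry all players expect the same when all play `x`, and zero-sum makes this common payoff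
`0` (`vsIdentical_self`). Hence every best response to `x` earns at least `0`. Equality needs a
symmetric equilibrium: an `x` all of whose used actions are optimal against `x`. No pure action then
beats the `x`-average, which is `0`, so `minMax` vanishes.

The equilibrium is found without a fixed-point theorem. Scarf's parity lemma
`exists_isDominating_image_eq_univ`, applied to a fine grid in the simplex (`exists_grid_rainbow`)
coloured by optimal actions, gives approximate equilibria; compactness gives an exact one
(`exists_stdSimplex_support_isMax`).

In the majority game the opponents agree on an action that the learner plays with probability at
most `1/2`; otherwise she is the minority and loses `1`. Answering her current mixed strategy in
this way in each round proves the repeated statement. -/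

/-! ### Scarf's lemma on dominating sets -/

section Dominating

variable {X I β : Type*} [LinearOrder β]

/-- Every point `y` is, for one of the orders `f i`, at most every element of `S`. -/
def IsDominating (f : I → X → β) (S : Finset X) : Prop :=
  ∀ y, ∃ i, ∀ x ∈ S, f i y ≤ f i x

theorem IsDominating.mono {f : I → X → β} {S T : Finset X} (hT : IsDominating f T)
    (h : S ⊆ T) : IsDominating f S := fun y =>
  let ⟨i, hi⟩ := hT y
  ⟨i, fun x hx => hi x (h hx)⟩

open Classical in
/-- The points that complete `τ` to a dominating set with one more element. -/
noncomputable def completions [Fintype X] (f : I → X → β) (τ : Finset X) : Finset X :=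
  Finset.univ.filter fun x => x ∉ τ ∧ IsDominating f (insert x τ)

theorem mem_completions [Fintype X] [DecidableEq X] {f : I → X → β} {τ : Finset X} {x : X} :
    x ∈ completions f τ ↔ x ∉ τ ∧ IsDominating f (insert x τ) := by
  simp only [completions, Finset.mem_filter, Finset.mem_univ, true_and]
  congr!

variable [DecidableEq X] [Fintype I] [DecidableEq I]

/-- Domination makes every element of `τ` the minimum `m i` of some order. There is one more order
than elements, so exactly one pair of orders `a`, `b` shares its minimum. A new point must take over
the minimum in `a` or in `b`, and is then the highest point in that order among those above the
minima of all the others. -/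
theorem card_completions_eq_two [Fintype X] {f : I → X → β} (hf : ∀ i, Function.Injective (f i))
    {τ : Finset X} (hcard : τ.card + 1 = Fintype.card I) (hne : τ.Nonempty)
    (hdom : IsDominating f τ)
    (hint : ∀ i, ∃ y, ∀ j, j ≠ i → ∃ x ∈ τ, f j x < f j y) :
    (completions f τ).card = 2 := by
  have hm : ∀ i, ∃ x ∈ τ, ∀ z ∈ τ, f i x ≤ f i z := fun i => τ.exists_min_image (f i) hne
  choose m hmτ hmin using hm
  have hcover : ∀ s : Finset I, (∀ y ∈ τ, ∃ j ∈ s, m j = y) → τ.card ≤ s.card := by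
    intro s hs
    refine le_trans (Finset.card_le_card ?_) (Finset.card_image_le (s := s) (f := m))
    intro y hy
    obtain ⟨j, hj, rfl⟩ := hs y hy
    exact Finset.mem_image_of_mem _ hj
  have hsurj : ∀ y ∈ τ, ∃ i, m i = y := by
    intro y hy
    obtain ⟨i, hi⟩ := hdom y
    exact ⟨i, hf i (le_antisymm (hmin i y hy) (hi _ (hmτ i)))⟩
  obtain ⟨a, -, b, -, hab, hmab⟩ := Finset.exists_ne_map_eq_of_card_lt_of_maps_to
    (s := (Finset.univ : Finset I)) (t := τ) (f := m)
    (by rw [Finset.card_univ]; omega) (fun i _ => hmτ i)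
  -- With two orders dropped, too few remain to reach all of `τ`.
  have hpair : ∀ i j : I, i ≠ j → ¬ ∀ y ∈ τ, ∃ k, k ≠ i ∧ k ≠ j ∧ m k = y := by
    intro i j hij h
    have h1 := hcover ((Finset.univ.erase i).erase j) fun y hy => by
      obtain ⟨k, hki, hkj, hk⟩ := h y hy
      exact ⟨k, by simp [hki, hkj], hk⟩
    rw [Finset.card_erase_of_mem (by simp [hij.symm]), Finset.card_erase_of_mem (by simp),
      Finset.card_univ] at h1
    have := hne.card_pos
    omega
  have hx : ∀ i, ∃ x, (∀ j, j ≠ i → f j (m j) < f j x) ∧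
      ∀ y, (∀ j, j ≠ i → f j (m j) < f j y) → f i y ≤ f i x := by
    intro i
    classical
    obtain ⟨x, hx, hmax⟩ := (Finset.univ.filter
      fun y => ∀ j, j ≠ i → f j (m j) < f j y).exists_max_image (f i) (by
        obtain ⟨y, hy⟩ := hint i
        refine ⟨y, Finset.mem_filter.2 ⟨Finset.mem_univ _, fun j hj => ?_⟩⟩
        obtain ⟨x, hx, hxy⟩ := hy j hj
        exact (hmin j x hx).trans_lt hxy)
    exact ⟨x, by simpa using hx, fun y hy => hmax y (by simpa using hy)⟩
  choose x hxM hxmax using hx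
  have hxm : ∀ i, f i (x i) ≤ f i (m i) := by
    intro i
    obtain ⟨j, hj⟩ := hdom (x i)
    by_cases hji : j = i
    · subst hji
      exact hj _ (hmτ j)
    · exact absurd (hj _ (hmτ j)) (not_le.2 (hxM i j hji))
  have hxdom : ∀ i, IsDominating f (insert (x i) τ) := by
    intro i y
    by_cases hy : ∀ j, j ≠ i → f j (m j) < f j y
    · refine ⟨i, fun z hz => ?_⟩
      rcases Finset.mem_insert.1 hz with rfl | hz
      · exact hxmax i y hy
      · exact ((hxmax i y hy).trans (hxm i)).trans (hmin i z hz)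
    · push Not at hy
      obtain ⟨j, hji, hj⟩ := hy
      refine ⟨j, fun z hz => ?_⟩
      rcases Finset.mem_insert.1 hz with rfl | hz
      · exact hj.trans (hxM i j hji).le
      · exact hj.trans (hmin j z hz)
  have hxτ : ∀ i, (∀ y ∈ τ, ∃ k, k ≠ i ∧ m k = y) → x i ∉ τ := by
    intro i hi hmem
    obtain ⟨k, hk, hmk⟩ := hi _ hmem
    have := hxM i k hk
    rw [hmk] at this
    exact lt_irrefl _ this
  have ha : ∀ y ∈ τ, ∃ k, k ≠ a ∧ m k = y := by
    intro y hy
    obtain ⟨k, rfl⟩ := hsurj y hy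
    by_cases hk : k = a
    · exact ⟨b, hab.symm, by rw [hk, hmab]⟩
    · exact ⟨k, hk, rfl⟩
  have hb : ∀ y ∈ τ, ∃ k, k ≠ b ∧ m k = y := by
    intro y hy
    obtain ⟨k, rfl⟩ := hsurj y hy
    by_cases hk : k = b
    · exact ⟨a, hab, by rw [hk, hmab]⟩
    · exact ⟨k, hk, rfl⟩
  have hxab : x a ≠ x b := by
    intro h
    have h1 := hxM b a hab
    rw [← h] at h1
    exact absurd (hxm a) (not_le.2 h1)
  suffices h : completions f τ = {x a, x b} by rw [h, Finset.card_pair hxab]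
  ext y
  rw [mem_completions, Finset.mem_insert, Finset.mem_singleton]
  constructor
  · rintro ⟨hyτ, hy⟩
    have hother : ∀ z ∈ τ, ∃ k, (∃ w ∈ τ, f k w < f k y) ∧ m k = z := by
      intro z hz
      obtain ⟨k, hk⟩ := hy z
      refine ⟨k, ⟨z, hz, lt_of_le_of_ne (hk y (Finset.mem_insert_self _ _)) fun h => ?_⟩, ?_⟩
      · exact hyτ (hf k h ▸ hz)
      · exact hf k (le_antisymm (hmin k z hz) (hk _ (Finset.mem_insert_of_mem (hmτ k))))
    obtain ⟨i, hi⟩ := hy y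
    have hne_i : ∀ j, (∀ w ∈ τ, f j y ≤ f j w) → ∀ k, (∃ w ∈ τ, f k w < f k y) → k ≠ j := by
      rintro j hj k ⟨w, hw, hlt⟩ rfl
      exact absurd (hj w hw) (not_le.2 hlt)
    have hi' : ∀ w ∈ τ, f i y ≤ f i w := fun w hw => hi w (Finset.mem_insert_of_mem hw)
    -- If `y` were lowest in a second order `j` too, the orders other than `i`, `j` would have to
    -- supply all minima of `τ`.
    have hyM : ∀ j, j ≠ i → f j (m j) < f j y := by
      intro j hji
      by_contra hcon
      refine hpair i j hji.symm fun z hz => ?_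
      obtain ⟨k, hk, hkz⟩ := hother z hz
      exact ⟨k, hne_i i hi' k hk,
        hne_i j (fun w hw => (not_lt.1 hcon).trans (hmin j w hw)) k hk, hkz⟩
    have hyx : y = x i := by
      refine hf i (le_antisymm (hxmax i y hyM) ?_)
      obtain ⟨j, hj⟩ := hy (x i)
      by_cases hji : j = i
      · subst hji
        exact hj y (Finset.mem_insert_self _ _)
      · exact absurd (hj _ (Finset.mem_insert_of_mem (hmτ j))) (not_le.2 (hxM i j hji))
    by_cases hia : i = a
    · exact Or.inl (hia ▸ hyx)
    by_cases hib : i = b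
    · exact Or.inr (hib ▸ hyx)
    exfalso
    refine hpair i a hia fun z hz => ?_
    obtain ⟨k, hk, hkz⟩ := hother z hz
    have hki := hne_i i hi' k hk
    by_cases hka : k = a
    · exact ⟨b, Ne.symm hib, hab.symm, by rw [← hmab, ← hka, hkz]⟩
    · exact ⟨k, hki, hka, hkz⟩
  · rintro (rfl | rfl)
    · exact ⟨hxτ a ha, hxdom a⟩
    · exact ⟨hxτ b hb, hxdom b⟩

/-- The boundary door: the points `e i` act as the outer facets, and the only completion is the `f
i₀`-highest point outside their range. -/
theorem card_completions_eq_one [Fintype X] {f : I → X → β} (hf : ∀ i, Function.Injective (f i))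
    (e : I → X) (hmin : ∀ i x, x ≠ e i → f i (e i) < f i x)
    (hmax : ∀ i j x, j ≠ i → x ∉ Set.range e → f i x < f i (e j))
    (hex : ∃ x, x ∉ Set.range e) (i₀ : I) :
    (completions f ((Finset.univ.erase i₀).image e)).card = 1 := by
  classical
  obtain ⟨x, hx, hxmax⟩ := (Finset.univ.filter
    fun x => x ∉ Set.range e).exists_max_image (f i₀) (by
      obtain ⟨x, hx⟩ := hex
      exact ⟨x, by simpa using hx⟩)
  replace hx : x ∉ Set.range e := by simpa using hx
  replace hxmax : ∀ y, y ∉ Set.range e → f i₀ y ≤ f i₀ x :=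
    fun y hy => hxmax y (by simpa using hy)
  have hτ : ∀ y, y ∈ (Finset.univ.erase i₀).image e ↔ ∃ j, j ≠ i₀ ∧ e j = y := by simp
  refine Finset.card_eq_one.2 ⟨x, ?_⟩
  ext y
  rw [mem_completions, Finset.mem_singleton, hτ]
  constructor
  · rintro ⟨hyτ, hy⟩
    obtain ⟨i, hi⟩ := hy x
    have hi₀ : i = i₀ := by
      by_contra hne
      exact absurd (hi (e i) (Finset.mem_insert_of_mem ((hτ _).2 ⟨i, hne, rfl⟩)))
        (not_le.2 (hmin i x fun h => hx ⟨i, h.symm⟩))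
    subst hi₀
    have hxy := hi y (Finset.mem_insert_self _ _)
    refine hf i (le_antisymm (hxmax y ?_) hxy)
    rintro ⟨j, rfl⟩
    by_cases hji : j = i
    · subst hji
      exact absurd hxy (not_le.2 (hmin j x fun h => hx ⟨j, h.symm⟩))
    · exact hyτ ⟨j, hji, rfl⟩
  · rintro rfl
    refine ⟨fun ⟨j, _, hj⟩ => hx ⟨j, hj⟩, fun z => ?_⟩
    by_cases hz : z ∈ Set.range e
    · obtain ⟨j, rfl⟩ := hz
      refine ⟨j, fun w _ => ?_⟩
      by_cases hw : w = e j
      · rw [hw]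
      · exact (hmin j w hw).le
    · refine ⟨i₀, fun w hw => ?_⟩
      rcases Finset.mem_insert.1 hw with rfl | hw
      · exact hxmax z hz
      · obtain ⟨j, hj, rfl⟩ := (hτ w).1 hw
        exact (hmax i₀ j z hj hz).le

/-- If `S` has exactly the colours other than `i₀`, one colour occurs twice, and only its two
carriers can be removed without losing a colour. -/
theorem even_card_filter_image_erase (c : X → I) (i₀ : I) {S : Finset X}
    (hS : S.card = Fintype.card I) (hc : S.image c ≠ Finset.univ) :
    Even (S.filter fun x => (S.erase x).image c = Finset.univ.erase i₀).card := by
  rcases (S.filter fun x => (S.erase x).image c = Finset.univ.erase i₀).eq_empty_or_nonempty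
    with h | ⟨x, hx⟩
  · simp [h]
  obtain ⟨hxS, hx⟩ := Finset.mem_filter.1 hx
  have himg : S.image c = insert (c x) (Finset.univ.erase i₀) := by
    rw [← hx, ← Finset.image_insert, Finset.insert_erase hxS]
  have hxi : c x ≠ i₀ := by
    intro h
    apply hc
    rw [himg, h, Finset.insert_erase (Finset.mem_univ _)]
  have hcx : c x ∈ (S.erase x).image c := by rw [hx]; simpa using hxi
  obtain ⟨y, hy, hyx⟩ := Finset.mem_image.1 hcx
  obtain ⟨hyx', hyS⟩ := Finset.mem_erase.1 hy
  have hpair : (S.filter fun x => (S.erase x).image c = Finset.univ.erase i₀) = {x, y} := by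
    ext z
    rw [Finset.mem_filter, Finset.mem_insert, Finset.mem_singleton]
    constructor
    · rintro ⟨hzS, hz⟩
      by_contra hcon
      push Not at hcon
      have hinj : Set.InjOn c (S.erase z) := by
        rw [← Finset.card_image_iff, hz, Finset.card_erase_of_mem (Finset.mem_univ _),
          Finset.card_erase_of_mem hzS, hS, Finset.card_univ]
      exact hyx' (hinj (by simpa using ⟨hyS, hcon.2.symm⟩) (by simpa using ⟨hxS, hcon.1.symm⟩) hyx)
    · rintro (rfl | rfl)
      · exact ⟨hxS, hx⟩
      · refine ⟨hyS, ?_⟩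
        have h1 : (S.erase z).image c = S.image c := by
          refine Finset.Subset.antisymm (Finset.image_subset_image (Finset.erase_subset _ _)) ?_
          intro k hk
          obtain ⟨w, hw, rfl⟩ := Finset.mem_image.1 hk
          by_cases hwz : w = z
          · rw [hwz, hyx]
            exact Finset.mem_image_of_mem _ (Finset.mem_erase.2 ⟨hyx'.symm, hxS⟩)
          · exact Finset.mem_image_of_mem _ (Finset.mem_erase.2 ⟨hwz, hw⟩)
        rw [h1, himg, Finset.insert_eq_of_mem (by simpa using hxi)]
  rw [hpair, Finset.card_pair hyx'.symm]
  exact even_two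

/-- A Sperner-type lemma for a finite set with finitely many linear orders, due to Scarf. -/
theorem exists_isDominating_image_eq_univ [Fintype X] {f : I → X → β} (hf : ∀ i, Function.Injective (f i))
    (e : I → X) (hmin : ∀ i x, x ≠ e i → f i (e i) < f i x)
    (hmax : ∀ i j x, j ≠ i → x ∉ Set.range e → f i x < f i (e j))
    (hex : ∃ x, x ∉ Set.range e) (c : X → I) (hce : ∀ i, c (e i) = i) [Nonempty I] :
    ∃ S : Finset X, S.image c = Finset.univ ∧ IsDominating f S := by
  classical
  by_contra hcon
  push Not at hcon
  obtain ⟨i₀⟩ := ‹Nonempty I›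
  have hIpos : 0 < Fintype.card I := Fintype.card_pos_iff.2 ⟨i₀⟩
  let R : Finset (Finset X) :=
    Finset.univ.filter fun S => S.card = Fintype.card I ∧ IsDominating f S
  let D : Finset (Finset X) := Finset.univ.filter fun τ =>
    τ.card + 1 = Fintype.card I ∧ τ.image c = Finset.univ.erase i₀
  -- Double counting of doors `τ` and rooms `S = insert x τ`. Without a fully coloured room the
  -- right side is even, while on the left `τ₀` contributes `1` and every other door `0` or `2`.
  have hcount : ∑ τ ∈ D, (completions f τ).card =
      ∑ S ∈ R, (S.filter fun x => (S.erase x).image c = Finset.univ.erase i₀).card := by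
    rw [← Finset.card_sigma, ← Finset.card_sigma]
    refine Finset.card_bij' (fun p _ => ⟨insert p.2 p.1, p.2⟩) (fun p _ => ⟨p.1.erase p.2, p.2⟩)
      ?_ ?_ ?_ ?_
    · rintro ⟨τ, x⟩ h
      simp only [Finset.mem_sigma, D, R, Finset.mem_filter, Finset.mem_univ, true_and,
        mem_completions] at h ⊢
      obtain ⟨⟨h1, h2⟩, h3, h4⟩ := h
      refine ⟨⟨by rw [Finset.card_insert_of_notMem h3, h1], h4⟩,
        Finset.mem_insert_self _ _, ?_⟩
      rw [Finset.erase_insert h3, h2]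
    · rintro ⟨S, x⟩ h
      simp only [Finset.mem_sigma, D, R, Finset.mem_filter, Finset.mem_univ, true_and,
        mem_completions] at h ⊢
      obtain ⟨⟨h1, h2⟩, h3, h4⟩ := h
      refine ⟨⟨by rw [Finset.card_erase_of_mem h3]; omega, h4⟩, Finset.notMem_erase _ _, ?_⟩
      rwa [Finset.insert_erase h3]
    · rintro ⟨τ, x⟩ h
      simp only [Finset.mem_sigma, mem_completions] at h
      simp [Finset.erase_insert h.2.1]
    · rintro ⟨S, x⟩ h
      simp only [Finset.mem_sigma, Finset.mem_filter] at h
      simp [Finset.insert_erase h.2.1]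
  have heven : Even (∑ τ ∈ D, (completions f τ).card) := by
    rw [hcount]
    refine Finset.even_sum _ fun S hS => ?_
    obtain ⟨h1, h2⟩ := (Finset.mem_filter.1 hS).2
    exact even_card_filter_image_erase c i₀ h1 fun h => hcon S h h2
  have heinj : Function.Injective e := Function.LeftInverse.injective hce
  set τ₀ := (Finset.univ.erase i₀).image e with hτ₀
  have hmem : τ₀ ∈ D := by
    refine Finset.mem_filter.2 ⟨Finset.mem_univ _, ?_, ?_⟩
    · rw [Finset.card_image_of_injective _ heinj, Finset.card_erase_of_mem (Finset.mem_univ _),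
        Finset.card_univ]
      omega
    · rw [hτ₀, Finset.image_image]
      have : c ∘ e = id := funext hce
      rw [this, Finset.image_id]
  rw [← Finset.add_sum_erase D _ hmem, card_completions_eq_one hf e hmin hmax hex i₀] at heven
  have hrest : Even (∑ τ ∈ D.erase τ₀, (completions f τ).card) := by
    refine Finset.even_sum _ fun τ hτ => ?_
    obtain ⟨hne, hτ⟩ := Finset.mem_erase.1 hτ
    obtain ⟨h1, h2⟩ := (Finset.mem_filter.1 hτ).2
    have hreal : ∃ x ∈ τ, x ∉ Set.range e := by
      by_contra hall
      push Not at hall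
      apply hne
      have h3 : ∀ x ∈ τ, e (c x) = x := by
        intro x hx
        obtain ⟨j, rfl⟩ := hall x hx
        rw [hce]
      rw [hτ₀, ← h2, Finset.image_image]
      ext x
      rw [Finset.mem_image]
      exact ⟨fun hx => ⟨x, hx, h3 x hx⟩, fun ⟨y, hy, hyx⟩ => by
        rw [← hyx, Function.comp_apply, h3 y hy]; exact hy⟩
    obtain ⟨x, hxτ, hx⟩ := hreal
    rcases (completions f τ).eq_empty_or_nonempty with h | ⟨z, hz⟩
    · simp [h]
    · rw [card_completions_eq_two hf h1 ⟨x, hxτ⟩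
        ((mem_completions.1 hz).2.mono (Finset.subset_insert _ _))
        fun i => ⟨e i, fun j hj => ⟨x, hxτ, hmax j i x hj.symm hx⟩⟩]
      exact even_two
  rw [Nat.even_add, iff_true_right hrest] at heven
  simp at heven

end Dominating

/-! ### Equilibria of continuous payoffs on the simplex -/

/-- For every colouring of the points of a fine grid in the simplex there is a face `C` and, for
each `i ∈ C`, a point `p i` of colour `i` near that face, such that all these points are close to
each other. -/
theorem exists_grid_rainbow {I : Type*} [Fintype I] [DecidableEq I] [Nonempty I] (N : ℕ)
    (c : (I → ℕ) → I) :
    ∃ (C : Finset I) (p : I → I → ℕ), C.Nonempty ∧ ∀ i ∈ C,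
      (∑ k, p i k = N) ∧ c (p i) = i ∧ (∀ k ∉ C, p i k ≤ Fintype.card I) ∧
        ∀ j ∈ C, ∀ k, p i k ≤ p j k + Fintype.card I := by
  classical
  let G : Finset (I → ℕ) := Finset.piAntidiag Finset.univ N
  have hG : ∀ q : I → ℕ, q ∈ G ↔ ∑ k, q k = N := by simp [G, Finset.mem_piAntidiag]
  let X := G ⊕ I
  -- Grid points get values in `1, …, N + 1`, so `0` and `N + 2` put the ideal point of `i` strictly
  -- below them in order `i` and strictly above in the others. The second component of `f` only
  -- breaks ties.
  let g : I → X → ℕ := fun i => Sum.elim (fun q => q.1 i + 1) (fun j => if j = i then 0 else N + 2)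
  let f : I → X → ℕ ×ₗ Fin (Fintype.card X) := fun i x => toLex (g i x, Fintype.equivFin X x)
  have hflt : ∀ i x y, g i x < g i y → f i x < f i y := fun i x y h =>
    Prod.Lex.toLex_lt_toLex.2 (Or.inl h)
  have hfle : ∀ i x y, f i x ≤ f i y → g i x ≤ g i y := fun i x y h =>
    not_lt.1 fun h' => absurd h (not_le.2 (hflt i y x h'))
  obtain ⟨i₁⟩ := ‹Nonempty I›
  have hq₀ : Pi.single i₁ N ∈ G := by rw [hG]; simp
  obtain ⟨S, hSc, hS⟩ := exists_isDominating_image_eq_univ (f := f)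
    (fun i x y h => by
      have h1 : (g i x, Fintype.equivFin X x) = (g i y, Fintype.equivFin X y) := toLex.injective h
      exact (Fintype.equivFin X).injective (Prod.ext_iff.1 h1).2)
    (Sum.inr : I → X)
    (by
      rintro i (q | j) h
      · exact hflt _ _ _ (by simp [g])
      · have : j ≠ i := fun hj => h (by rw [hj])
        exact hflt _ _ _ (by simp [g, this]))
    (by
      rintro i j (q | k) hj h
      · have h1 : q.1 i ≤ N := by
          rw [← (hG q.1).1 q.2]
          exact Finset.single_le_sum (f := q.1) (fun _ _ => Nat.zero_le _) (Finset.mem_univ i)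
        exact hflt _ _ _ (by simp only [g, Sum.elim_inl, Sum.elim_inr, if_neg hj]; omega)
      · exact absurd ⟨k, rfl⟩ h)
    ⟨Sum.inl ⟨_, hq₀⟩, by simp⟩ (Sum.elim (fun q => c q.1) id) (fun i => rfl)
  let C : Finset I := Finset.univ.filter fun i => Sum.inr i ∉ S
  have hC : ∀ i, i ∈ C ↔ Sum.inr i ∉ S := by simp [C]
  have hcol : ∀ i ∈ C, ∃ q : G, Sum.inl q ∈ S ∧ c q.1 = i := by
    intro i hi
    have : i ∈ S.image (Sum.elim (fun q : G => c q.1) id) := by rw [hSc]; exact Finset.mem_univ _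
    obtain ⟨q | j, hq, hqi⟩ := Finset.mem_image.1 this
    · exact ⟨q, hq, hqi⟩
    · obtain rfl : j = i := hqi
      exact absurd hq ((hC _).1 hi)
  have hdom : ∀ q ∈ G, ∃ i ∈ C, ∀ r : G, Sum.inl r ∈ S → q i ≤ r.1 i := by
    intro q hq
    obtain ⟨i, hi⟩ := hS (Sum.inl ⟨q, hq⟩)
    refine ⟨i, (hC i).2 fun h => ?_, fun r hr => ?_⟩
    · simpa [g] using hfle _ _ _ (hi _ h)
    · simpa [g] using hfle _ _ _ (hi _ hr)
  obtain ⟨k₀, hk₀, -⟩ := hdom _ hq₀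
  have hσ : (Finset.univ.filter fun q : G => Sum.inl q ∈ S).Nonempty := by
    obtain ⟨q, hq, -⟩ := hcol k₀ hk₀
    exact ⟨q, by simpa using hq⟩
  have hu : ∀ i, ∃ u : G, Sum.inl u ∈ S ∧ ∀ r : G, Sum.inl r ∈ S → u.1 i ≤ r.1 i := by
    intro i
    obtain ⟨u, hu, hmin⟩ := Finset.exists_min_image _ (fun q : G => q.1 i) hσ
    exact ⟨u, by simpa using hu, fun r hr => hmin r (by simpa using hr)⟩
  choose u huS hu using hu
  -- Otherwise some grid point exceeds the minima of `S` in all coordinates of `C`, against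
  -- domination. So the minima nearly exhaust `N`, which forces the points together.
  have hsum : N < ∑ i ∈ C, ((u i).1 i + 1) := by
    by_contra hcon
    push Not at hcon
    let w : I → ℕ := fun i => if i ∈ C then (u i).1 i + 1 else 0
    have hw : ∑ i, w i = ∑ i ∈ C, ((u i).1 i + 1) := by
      simp [w, Finset.sum_ite_mem]
    obtain ⟨i, hi, hle⟩ := hdom (w + Pi.single k₀ (N - ∑ i, w i)) (by
      rw [hG]
      simp only [Pi.add_apply, Finset.sum_add_distrib, Finset.sum_pi_single', Finset.mem_univ,
        if_true]
      omega)
    have h1 := hle (u i) (huS i)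
    simp only [Pi.add_apply, w, if_pos hi] at h1
    omega
  have hCcard : C.card ≤ Fintype.card I := Finset.card_le_univ _
  have hbound : ∀ r : G, Sum.inl r ∈ S → (∀ k ∉ C, r.1 k ≤ Fintype.card I) ∧
      ∀ s : G, Sum.inl s ∈ S → ∀ k ∈ C, r.1 k ≤ s.1 k + Fintype.card I := by
    intro r hr
    have hrN := (hG r.1).1 r.2
    rw [Finset.sum_add_distrib] at hsum
    simp only [Finset.sum_const, smul_eq_mul, mul_one] at hsum
    constructor
    · intro k hk
      have h1 : ∑ i ∈ insert k C, r.1 i ≤ N := hrN ▸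
        Finset.sum_le_sum_of_subset (Finset.subset_univ _)
      rw [Finset.sum_insert hk] at h1
      have h2 : ∑ i ∈ C, (u i).1 i ≤ ∑ i ∈ C, r.1 i := Finset.sum_le_sum fun i _ => hu i r hr
      omega
    · intro s hs k hk
      have h1 : ∑ i ∈ C, r.1 i ≤ N := hrN ▸
        Finset.sum_le_sum_of_subset (Finset.subset_univ _)
      have h2 : ∑ i ∈ C.erase k, (u i).1 i ≤ ∑ i ∈ C.erase k, r.1 i :=
        Finset.sum_le_sum fun i _ => hu i r hr
      rw [← Finset.add_sum_erase _ _ hk] at h1 hsum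
      have h3 := hu k s hs
      omega
  have hp : ∀ i, ∃ q : G, i ∈ C → Sum.inl q ∈ S ∧ c q.1 = i := by
    intro i
    by_cases hi : i ∈ C
    · obtain ⟨q, hq⟩ := hcol i hi
      exact ⟨q, fun _ => hq⟩
    · exact ⟨⟨_, hq₀⟩, fun h => absurd h hi⟩
  choose p hp using hp
  refine ⟨C, fun i => (p i).1, ⟨k₀, hk₀⟩, fun i hi => ⟨(hG _).1 (p i).2, (hp i hi).2,
    (hbound _ (hp i hi).1).1, fun j hj k => ?_⟩⟩
  by_cases hk : k ∈ C
  · exact (hbound _ (hp i hi).1).2 _ (hp j hj).1 k hk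
  · exact ((hbound _ (hp i hi).1).1 k hk).trans (Nat.le_add_left _ _)

/-- Colour each grid point by an index maximising `H` there. Near a rainbow family all indices in
`C` are almost maximal, and those outside `C` have tiny weight. -/
theorem exists_stdSimplex_forall_le_or_le {I : Type*} [Fintype I] [Nonempty I]
    {H : stdSimplex ℝ I → I → ℝ} (hH : Continuous H) {ε : ℝ} (hε : 0 < ε) :
    ∃ q : stdSimplex ℝ I, ∀ a b, q.1 a ≤ ε ∨ H q b ≤ H q a + ε := by
  classical
  have huc : UniformContinuous H := CompactSpace.uniformContinuous_of_continuous hH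
  obtain ⟨δ, hδ, hHδ⟩ := Metric.uniformContinuous_iff.1 huc (ε / 2) (half_pos hε)
  obtain ⟨N, hN⟩ := exists_nat_gt ((Fintype.card I : ℝ) / min δ ε)
  have hmin : 0 < min δ ε := lt_min hδ hε
  have hcardpos : (0 : ℝ) < Fintype.card I := by exact_mod_cast Fintype.card_pos
  have hN0 : (0 : ℝ) < N := (div_pos hcardpos hmin).trans hN
  have hNlt : (Fintype.card I : ℝ) / N < min δ ε := by
    rw [div_lt_iff₀ hmin] at hN
    rw [div_lt_iff₀ hN0]
    linarith
  -- Off the grid the value is an arbitrary vertex.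
  have hpt : ∀ p : I → ℕ, ∃ x : stdSimplex ℝ I, ∑ k, p k = N → ∀ k, x.1 k = p k / N := by
    intro p
    by_cases hp : ∑ k, p k = N
    · refine ⟨⟨fun k => p k / N, fun k => by positivity, ?_⟩, fun _ k => rfl⟩
      rw [← Finset.sum_div, ← Nat.cast_sum, hp, div_self hN0.ne']
    · obtain ⟨i⟩ := ‹Nonempty I›
      exact ⟨⟨_, single_mem_stdSimplex ℝ i⟩, fun h => absurd h hp⟩
  choose pt hpt using hpt
  have hcol : ∀ p, ∃ i, ∀ b, H (pt p) b ≤ H (pt p) i := fun p => by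
    obtain ⟨i, -, hi⟩ := Finset.univ.exists_max_image (H (pt p)) Finset.univ_nonempty
    exact ⟨i, fun b => hi b (Finset.mem_univ b)⟩
  choose c hc using hcol
  obtain ⟨C, p, ⟨i₁, hi₁⟩, h⟩ := exists_grid_rainbow N c
  refine ⟨pt (p i₁), fun a b => ?_⟩
  obtain ⟨hs₁, -, hface, hclose⟩ := h i₁ hi₁
  by_cases ha : a ∈ C
  · right
    obtain ⟨hs, hca, -, hclose'⟩ := h a ha
    have hdist : dist (pt (p i₁)) (pt (p a)) < δ := by
      rw [Subtype.dist_eq, dist_pi_lt_iff hδ]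
      intro k
      rw [hpt _ hs₁, hpt _ hs, Real.dist_eq, ← sub_div, abs_div, abs_of_pos hN0]
      refine lt_of_le_of_lt ?_ (hNlt.trans_le (min_le_left _ _))
      have h1 : (p i₁ k : ℝ) ≤ p a k + Fintype.card I := by exact_mod_cast hclose a ha k
      have h2 : (p a k : ℝ) ≤ p i₁ k + Fintype.card I := by exact_mod_cast hclose' i₁ hi₁ k
      gcongr
      rw [abs_le]
      constructor <;> linarith
    have hHd := (dist_pi_lt_iff (half_pos hε)).1 (hHδ hdist)
    have h1 := abs_lt.1 (hHd a)
    have h2 := abs_lt.1 (hHd b)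
    have h3 := hc (p a) b
    rw [hca] at h3
    linarith [h1.1, h1.2, h2.1, h2.2]
  · left
    rw [hpt _ hs₁]
    have h1 : (p i₁ a : ℝ) ≤ Fintype.card I := by exact_mod_cast hface a ha
    calc (p i₁ a : ℝ) / N ≤ Fintype.card I / N := by gcongr
      _ ≤ ε := (hNlt.trans_le (min_le_right _ _)).le

/-- A continuous family of payoffs on the simplex has an equilibrium: a point supported on the
coordinates whose payoff is maximal. -/
theorem exists_stdSimplex_support_isMax {I : Type*} [Fintype I] [Nonempty I]
    {H : stdSimplex ℝ I → I → ℝ} (hH : Continuous H) :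
    ∃ x : stdSimplex ℝ I, ∀ a b, 0 < x.1 a → H x b ≤ H x a := by
  classical
  -- A continuous nonnegative gap that vanishes exactly at equilibria; approximate ones make its
  -- minimum `0`.
  let φ : stdSimplex ℝ I → ℝ := fun q => ∑ a, ∑ b, min (q.1 a) (max 0 (H q b - H q a))
  have hφ : Continuous φ := by
    have h1 : ∀ a, Continuous fun q : stdSimplex ℝ I => q.1 a := fun a =>
      (continuous_apply a).comp continuous_subtype_val
    have h2 : ∀ a, Continuous fun q => H q a := fun a => (continuous_apply a).comp hH
    exact continuous_finsetSum _ fun a _ => continuous_finsetSum _ fun b _ =>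
      (h1 a).min (continuous_const.max ((h2 b).sub (h2 a)))
  have hterm : ∀ (q : stdSimplex ℝ I) a b, 0 ≤ min (q.1 a) (max 0 (H q b - H q a)) :=
    fun q a b => le_min (q.2.1 a) (le_max_left _ _)
  obtain ⟨x, -, hx⟩ := isCompact_univ.exists_isMinOn Set.univ_nonempty hφ.continuousOn
  have hx0 : φ x ≤ 0 := by
    refine le_of_forall_pos_le_add fun ε hε => ?_
    have hcard : (0 : ℝ) < Fintype.card I := by exact_mod_cast Fintype.card_pos
    obtain ⟨q, hq⟩ := exists_stdSimplex_forall_le_or_le hH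
      (div_pos hε (mul_pos hcard hcard))
    have h1 : φ q ≤ ∑ _a : I, ∑ _b : I, ε / (Fintype.card I * Fintype.card I) := by
      refine Finset.sum_le_sum fun a _ => Finset.sum_le_sum fun b _ => ?_
      rcases hq a b with h | h
      · exact (min_le_left _ _).trans h
      · exact (min_le_right _ _).trans (max_le (by positivity) (by linarith))
    have h2 : ∑ _a : I, ∑ _b : I, ε / (Fintype.card I * Fintype.card I) = ε := by
      simp only [Finset.sum_const, Finset.card_univ, nsmul_eq_mul]
      field_simp
    linarith [isMinOn_iff.1 hx q (Set.mem_univ q)]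
  refine ⟨x, fun a b ha => ?_⟩
  by_contra hlt
  push Not at hlt
  have h1 : 0 < min (x.1 a) (max 0 (H x b - H x a)) :=
    lt_min ha (lt_max_of_lt_right (sub_pos.2 hlt))
  have h2 : min (x.1 a) (max 0 (H x b - H x a)) ≤ φ x :=
    (Finset.single_le_sum (f := fun b => min (x.1 a) (max 0 (H x b - H x a)))
      (fun b _ => hterm x a b) (Finset.mem_univ b)).trans
    (Finset.single_le_sum (f := fun a => ∑ b, min (x.1 a) (max 0 (H x b - H x a)))
      (fun a _ => Finset.sum_nonneg fun b _ => hterm x a b) (Finset.mem_univ a))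
  linarith

/-! ### Symmetric zero-sum games -/

namespace Payoffs

variable {n : ℕ} [NeZero n] {A : Type*} [Fintype A]

open Classical in
/-- The expected payoff of the learner for the pure action `b` when all other players
play `x`. -/
noncomputable def pureVsIdentical (U : Payoffs n A) (x : MixedStrategy A) (b : A) : ℝ :=
  ∑ a : Fin n → A, if b = a 0 then (∏ j ∈ Finset.univ.erase 0, x.1 (a j)) * U 0 a else 0

theorem vsIdentical_eq_sum (U : Payoffs n A) (x₁ x : MixedStrategy A) :
    U.vsIdentical x₁ x = ∑ b, x₁.1 b * U.pureVsIdentical x b := by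
  classical
  simp only [vsIdentical, expected, pureVsIdentical, Finset.mul_sum]
  rw [Finset.sum_comm]
  refine Finset.sum_congr rfl fun a _ => ?_
  simp only [mul_ite, mul_zero, Finset.sum_ite_eq', Finset.mem_univ, if_true]
  rw [← Finset.mul_prod_erase _ _ (Finset.mem_univ (0 : Fin n)), Function.update_self, mul_assoc]
  congr 2
  refine Finset.prod_congr rfl fun j hj => ?_
  rw [Function.update_of_ne (Finset.ne_of_mem_erase hj)]

theorem continuous_pureVsIdentical (U : Payoffs n A) : Continuous U.pureVsIdentical := by
  refine continuous_pi fun b => ?_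
  refine continuous_finsetSum _ fun a _ => ?_
  split_ifs
  · exact (continuous_finsetProd _ fun j _ =>
      (continuous_apply (a j)).comp continuous_subtype_val).mul continuous_const
  · exact continuous_const

theorem continuous_vsIdentical (U : Payoffs n A) :
    Continuous fun p : MixedStrategy A × MixedStrategy A => U.vsIdentical p.1 p.2 := by
  simp only [vsIdentical_eq_sum]
  exact continuous_finsetSum _ fun b _ =>
    ((continuous_apply b).comp (continuous_subtype_val.comp continuous_fst)).mul
      ((continuous_apply b).comp (U.continuous_pureVsIdentical.comp continuous_snd))

theorem expected_const_eq {U : Payoffs n A} (hU : U.IsSymmetric) (x : MixedStrategy A)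
    (i : Fin n) : U.expected i (fun _ => x) = U.expected 0 (fun _ => x) := by
  classical
  let π : Equiv.Perm (Fin n) := Equiv.swap 0 i
  unfold expected
  refine Fintype.sum_equiv (Equiv.arrowCongr π.symm (Equiv.refl A)) _ _ fun a => ?_
  have h1 : (Equiv.arrowCongr π.symm (Equiv.refl A)) a = fun j => a (π j) := rfl
  rw [h1, hU π 0 a, Equiv.prod_comp π fun j => x.1 (a j)]
  simp [π]

theorem vsIdentical_self {U : Payoffs n A} (hU : U.IsSymmetric) (hU₀ : U.IsZeroSum)
    (x : MixedStrategy A) : U.vsIdentical x x = 0 := by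
  have h1 : ∑ i, U.expected i (fun _ => x) = 0 := by
    unfold expected
    rw [Finset.sum_comm]
    refine Finset.sum_eq_zero fun a _ => ?_
    rw [← Finset.mul_sum, hU₀ a, mul_zero]
  simp only [expected_const_eq hU x, Finset.sum_const, Finset.card_univ, Fintype.card_fin,
    nsmul_eq_mul] at h1
  have hn : (n : ℝ) ≠ 0 := by exact_mod_cast NeZero.ne n
  have h2 : Function.update (fun _ : Fin n => x) 0 x = fun _ => x := Function.update_eq_self 0 _
  rw [vsIdentical, h2]
  exact (mul_eq_zero.1 h1).resolve_left hn

theorem continuous_worstCase (U : Payoffs n A) : Continuous U.worstCase := by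
  have h := IsCompact.continuous_sInf (f := fun x₁ x : MixedStrategy A => U.vsIdentical x₁ x)
    isCompact_univ U.continuous_vsIdentical
  simp only [Set.image_univ] at h
  exact h

theorem continuous_bestResponse (U : Payoffs n A) : Continuous U.bestResponse := by
  have h := IsCompact.continuous_sSup (f := fun x x₁ : MixedStrategy A => U.vsIdentical x₁ x)
    isCompact_univ (U.continuous_vsIdentical.comp continuous_swap)
  simp only [Set.image_univ] at h
  exact h

theorem optimaAttained [Nonempty A] (U : Payoffs n A) : U.OptimaAttained := by
  have h := U.continuous_vsIdentical
  refine ⟨fun x₁ => ?_, ?_, fun x => ?_, ?_⟩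
  · exact (isCompact_range (by fun_prop)).isLeast_sInf (Set.range_nonempty _)
  · exact (isCompact_range U.continuous_worstCase).isGreatest_sSup (Set.range_nonempty _)
  · exact (isCompact_range (by fun_prop)).isGreatest_sSup (Set.range_nonempty _)
  · exact (isCompact_range U.continuous_bestResponse).isLeast_sInf (Set.range_nonempty _)

theorem maxMin_le_minMax [Nonempty A] (U : Payoffs n A) : U.maxMin ≤ U.minMax := by
  obtain ⟨h1, h2, h3, h4⟩ := U.optimaAttained
  obtain ⟨x₁, hx₁⟩ := h2.1
  obtain ⟨x, hx⟩ := h4.1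
  rw [← hx₁, ← hx]
  exact ((h1 x₁).2 ⟨x, rfl⟩).trans ((h3 x).2 ⟨x₁, rfl⟩)

theorem minMax_eq_zero [Nonempty A] {U : Payoffs n A} (hU : U.IsSymmetric) (hU₀ : U.IsZeroSum) :
    U.minMax = 0 := by
  obtain ⟨-, -, h3, h4⟩ := U.optimaAttained
  apply le_antisymm
  · obtain ⟨x, hx⟩ := exists_stdSimplex_support_isMax U.continuous_pureVsIdentical
    refine (h4.2 ⟨x, rfl⟩).trans ((isLUB_le_iff (h3 x).isLUB).2 ?_)
    rintro _ ⟨x₁, rfl⟩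
    -- `0` is the `x`-average of the pure payoffs, and on the support of `x` these are all maximal.
    have hb : ∀ b, U.pureVsIdentical x b ≤ 0 := by
      intro b
      rw [← vsIdentical_self hU hU₀ x, vsIdentical_eq_sum, ← one_mul (U.pureVsIdentical x b),
        ← x.2.2, Finset.sum_mul]
      refine Finset.sum_le_sum fun a _ => ?_
      rcases (x.2.1 a).eq_or_lt with h | h
      · simp [← h]
      · exact mul_le_mul_of_nonneg_left (hx a b h) h.le
    change U.vsIdentical x₁ x ≤ 0
    rw [vsIdentical_eq_sum]
    exact Finset.sum_nonpos fun b _ => mul_nonpos_of_nonneg_of_nonpos (x₁.2.1 b) (hb b)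
  · obtain ⟨x, hx⟩ := h4.1
    rw [← hx, ← vsIdentical_self hU hU₀ x]
    exact (h3 x).2 ⟨x, rfl⟩

theorem pureVsIdentical_single [DecidableEq A] (U : Payoffs n A) (c b : A) :
    U.pureVsIdentical ⟨_, single_mem_stdSimplex ℝ c⟩ b =
      U 0 (Function.update (fun _ => c) 0 b) := by
  unfold pureVsIdentical
  rw [Finset.sum_eq_single (Function.update (fun _ => c) 0 b)]
  · rw [Function.update_self, if_pos rfl, Finset.prod_eq_one, one_mul]
    intro j hj
    rw [Function.update_of_ne (Finset.ne_of_mem_erase hj)]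
    exact Pi.single_eq_same c 1
  · intro a _ ha
    split_ifs with hb
    · obtain ⟨j, hj⟩ := Function.ne_iff.1 ha
      have hj0 : j ≠ 0 := by
        rintro rfl
        rw [Function.update_self] at hj
        exact hj hb.symm
      rw [Function.update_of_ne hj0] at hj
      rw [Finset.prod_eq_zero (Finset.mem_erase.2 ⟨hj0, Finset.mem_univ j⟩), zero_mul]
      exact Pi.single_eq_of_ne hj 1
    · rfl
  · exact fun h => absurd (Finset.mem_univ _) h

end Payoffs

/-! ### The three-player majority game -/

theorem majorityGame_isSymmetric : majorityGame.IsSymmetric := by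
  intro π i a
  have h1 : (∀ j k, a (π j) = a (π k)) ↔ ∀ j k, a j = a k :=
    ⟨fun h j k => by simpa using h (π.symm j) (π.symm k), fun h j k => h _ _⟩
  have h2 : (∃ j, j ≠ i ∧ a (π j) = a (π i)) ↔ ∃ j, j ≠ π i ∧ a j = a (π i) :=
    ⟨fun ⟨j, hj, h⟩ => ⟨π j, fun h' => hj (π.injective h'), h⟩,
      fun ⟨j, hj, h⟩ => ⟨π.symm j, fun h' => hj (by rw [← h', Equiv.apply_symm_apply]),
        by rwa [Equiv.apply_symm_apply]⟩⟩
  simp only [majorityGame, h1, h2]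

theorem majorityGame_isZeroSum : majorityGame.IsZeroSum := by
  intro a
  have h : ∀ p : Fin 2, p = 0 ∨ p = 1 := by decide
  rcases h (a 0) with h0 | h0 <;> rcases h (a 1) with h1 | h1 <;> rcases h (a 2) with h2 | h2 <;>
    norm_num [Fin.sum_univ_three, majorityGame, Fin.forall_fin_succ, Fin.exists_fin_succ,
      h0, h1, h2, show (2 : Fin 3) ≠ 0 by decide, show (2 : Fin 3) ≠ 1 by decide,
      show (0 : Fin 3) ≠ 2 by decide, show (1 : Fin 3) ≠ 2 by decide]

theorem exists_majorityGame_vsIdentical_le (x₁ : MixedStrategy (Fin 2)) :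
    ∃ y, majorityGame.vsIdentical x₁ y ≤ -1 / 2 := by
  have hval : ∀ c b : Fin 2, majorityGame 0 (Function.update (fun _ => c) 0 b) =
      if b = c then 0 else -1 := by
    intro c b
    fin_cases c <;> fin_cases b <;>
      simp [majorityGame, Fin.forall_fin_succ, Function.update]
  have hc : ∃ c : Fin 2, 1 / 2 ≤ x₁.1 (1 - c) := by
    have hsum : x₁.1 0 + x₁.1 1 = 1 := by rw [← Fin.sum_univ_two]; exact x₁.2.2
    rcases le_total (x₁.1 0) (x₁.1 1) with h | h
    · exact ⟨0, by change 1 / 2 ≤ x₁.1 1; linarith⟩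
    -- In `Fin 2`, `1 - c` is the other action; against the pure `c` the learner's payoff is minus
    -- its weight.
    · exact ⟨1, by change 1 / 2 ≤ x₁.1 0; linarith⟩
  obtain ⟨c, hc⟩ := hc
  refine ⟨⟨_, single_mem_stdSimplex ℝ c⟩, ?_⟩
  simp only [Payoffs.vsIdentical_eq_sum, Payoffs.pureVsIdentical_single, hval, Fin.sum_univ_two]
  fin_cases c <;> simp at hc ⊢ <;> linarith

theorem majorityGame_maxMin_le : majorityGame.maxMin ≤ -1 / 2 := by
  obtain ⟨h1, h2, -, -⟩ := majorityGame.optimaAttained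
  obtain ⟨x₁, hx₁⟩ := h2.1
  obtain ⟨y, hy⟩ := exists_majorityGame_vsIdentical_le x₁
  rw [← hx₁]
  exact ((h1 x₁).2 ⟨y, rfl⟩).trans hy

theorem exists_opponents_majorityGame_averagePayoff_le (learner : AdaptiveRule 3 (Fin 2)) :
    ∃ opponents : AdaptiveRule 3 (Fin 2), ∀ (a : ℕ → (Fin 3 → Fin 2)) (T : ℕ), 1 ≤ T →
      majorityGame.averagePayoff learner opponents a T ≤ -1 / 2 := by
  choose y hy using exists_majorityGame_vsIdentical_le
  refine ⟨fun t h => y (learner t h), fun a T hT => ?_⟩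
  have hT' : (0 : ℝ) < T := by exact_mod_cast hT
  unfold Payoffs.averagePayoff
  rw [one_div, inv_mul_le_iff₀ hT', ← nsmul_eq_mul]
  have h := Finset.sum_le_card_nsmul (Finset.range T)
    (fun t => majorityGame.vsIdentical (learner t fun s => a s) (y (learner t fun s => a s)))
    (-1 / 2) fun t _ => hy _
  rwa [Finset.card_range] at h

theorem mainTheorem7 :
    (∀ (n : ℕ) [NeZero n] (A : Type*) [Fintype A] [Nonempty A] (U : Payoffs n A),
      U.IsSymmetric → U.IsZeroSum →
        U.OptimaAttained ∧ U.maxMin ≤ U.minMax ∧ U.minMax = 0) ∧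
    (majorityGame.IsSymmetric ∧ majorityGame.IsZeroSum ∧
      majorityGame.maxMin ≤ -1 / 2 ∧ majorityGame.maxMin < majorityGame.minMax) ∧
    (∀ learner : AdaptiveRule 3 (Fin 2), ∃ opponents : AdaptiveRule 3 (Fin 2),
      ∀ (a : ℕ → (Fin 3 → Fin 2)) (T : ℕ), 1 ≤ T →
        majorityGame.averagePayoff learner opponents a T ≤ -1 / 2) := by
  have hlt : majorityGame.maxMin < majorityGame.minMax := by
    rw [Payoffs.minMax_eq_zero majorityGame_isSymmetric majorityGame_isZeroSum]
    exact majorityGame_maxMin_le.trans_lt (by norm_num)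
  exact ⟨fun n _ A _ _ U hU hU₀ => ⟨U.optimaAttained, U.maxMin_le_minMax,
      Payoffs.minMax_eq_zero hU hU₀⟩,
    ⟨majorityGame_isSymmetric, majorityGame_isZeroSum, majorityGame_maxMin_le, hlt⟩,
    exists_opponents_majorityGame_averagePayoff_le⟩
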